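/- Let $\Lambda$ be a countable group with $\Lambda\neq\{1\}$, let $H,K\le\Lambda$ be subgroups, let $\phi:H\to K$ be an isomorphism, and let $$\Gamma=HNN(\Lambda,H,K,\phi)=\langle \Lambda,t \mid t^{-1}ht=\phi(h)\ \ (h\in H)\rangle$$ be the HNN extension with stable letter $t$; put $\Gamma_0=\langle t\rangle$. For $j\ge 1$ let $\phi^j$ be the $j$-th power of the partial map $\phi$ of $\Lambda$, with domain $\mathrm{Dom}(\phi)=H$ and $\mathrm{Dom}(\phi^j)=\phi^{-1}(\mathrm{Dom}(\phi^{j-1})\cap K)$ for $j\ge 2$. Suppose that for every $j\geq 1$ the map $\phi^j$ has no nontrivial fixed point, that is, $h\in\mathrm{Dom}(\phi^j)$ and $\phi^j(h)=h$ imply $h=1$. Then: 1. $\Gamma$ is ICC: the conjugacy class of every $g\in\Gamma\setminus\{1\}$ is infinite. 2. The pair $(\Gamma,\Gamma_0)$ satisfies condition (ST): for every finite subset $C\subset\Gamma\setminus\Gamma_0$ there is a finite subset $E\subset\Gamma_0$ such that $g g_0 h\notin\Gamma_0$ for all $g_0\in\Gamma_0\setminus E$ and all $g,h\in C$. 3.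 The group von Neumann algebra $L(\Gamma)$ is a type $\mathrm{II}_1$ factor, and $L(\Gamma_0)$ is strongly mixing in $L(\Gamma)$. Here $L(\Gamma)$ and $L(\Gamma_0)\subset L(\Gamma)$ are the von Neumann algebras on $\ell^2(\Gamma)$ generated by the left regular representation $\lambda$ of $\Gamma$, respectively its restriction to $\Gamma_0$; $\tau(x)=\langle x\delta_1,\delta_1\rangle$ is the canonical trace on $M=L(\Gamma)$, and $\|x\|_2=\tau(x^*x)^{1/2}$. For a von Neumann subalgebra $A\subset M$, $E_A$ is the $\tau$-preserving conditional expectation of $M$ onto $A$. An infinite set $S$ of unitaries of $M$ is *almost orthonormal* if for all $x\in M$ and $\varepsilon>0$ one has $|\tau(ux)|\le\varepsilon$ for all but finitely many $u\in S$. An abelian von Neumann subalgebra $A\subset M$ is *strongly mixing* in $M$ if for every almost orthonormal infinite subgroup $G$ of the unitary group $U(A)$ and all $x,y\in M$, $$\lim_{u\to\infty,\ u\in G}\|E_A(uxu^{-1}y)-E_A(x)E_A(y)\|_2=0,$$ where $u\to\infty$ in $G$ means leaving every finite subset of $G$. -/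

import Mathlib

open Filter Topology
open scoped ENNReal

namespace HNNMixing

/-! ### Groups -/

section Groups

variable {Λ : Type*} [Group Λ] {H K : Subgroup Λ}

/-- The HNN extension `HNN(Λ, H, K, φ)` with the convention `t⁻¹ h t = φ h` for `h ∈ H`
(see `t_inv_mul_of_mul_t`). Mathlib's `HNNExtension G A B ψ` has `t a t⁻¹ = ψ a` for `a ∈ A`, so
it is used with `A = K`, `B = H`, `ψ = φ⁻¹`. -/
abbrev HNN (φ : H ≃* K) : Type _ := HNNExtension Λ K H φ.symm

/-- The stable letter. -/
abbrev stableLetter (φ : H ≃* K) : HNN φ := HNNExtension.t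

theorem t_inv_mul_of_mul_t (φ : H ≃* K) (h : H) :
    (stableLetter φ)⁻¹ * HNNExtension.of (h : Λ) * stableLetter φ
      = HNNExtension.of (φ h : Λ) := by
  have := HNNExtension.equiv_symm_eq_conj (φ := φ.symm) h
  simpa using this.symm

/-- The `j`-th power of the partially defined map `φ : H → K ⊆ Λ`: the element `φʲ x` is defined
for `j ≥ 1` if and only if `x ∈ H` and `φʲ⁻¹` is defined at `φ x`, and then
`φʲ x = φʲ⁻¹ (φ x)`. Thus `y ∈ partialPow φ j x` says that `x ∈ Dom(φʲ)` and `φʲ x = y`. -/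
def partialPow (φ : H ≃* K) : ℕ → Λ → Part Λ
  | 0, x => Part.some x
  | j + 1, x => Part.assert (x ∈ H) fun hx => partialPow φ j (φ ⟨x, hx⟩ : Λ)

/-- Every conjugacy class other than that of the identity is infinite. -/
def IsICC (Γ : Type*) [Group Γ] : Prop :=
  ∀ g : Γ, g ≠ 1 → {x : Γ | ∃ h : Γ, x = h * g * h⁻¹}.Infinite

/-- Condition (ST) for a pair of groups `Γ₀ ≤ Γ`. -/
def ConditionST {Γ : Type*} [Group Γ] (Γ₀ : Subgroup Γ) : Prop :=
  ∀ C : Finset Γ, (∀ c ∈ C, c ∉ Γ₀) →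
    ∃ E : Finset Γ, (∀ e ∈ E, e ∈ Γ₀) ∧
      ∀ g₀ ∈ Γ₀, g₀ ∉ E → ∀ g ∈ C, ∀ h ∈ C, g * g₀ * h ∉ Γ₀

end Groups

/-! ### Von Neumann algebras -/

section VonNeumann

variable {𝓗 : Type*} [NormedAddCommGroup 𝓗] [InnerProductSpace ℂ 𝓗] [CompleteSpace 𝓗]

/-- The von Neumann algebra generated by a set `S` of bounded operators: the double commutant of
`S ∪ S*` (`StarSubalgebra.centralizer ℂ S` is the commutant of `S ∪ S*`). -/
noncomputable def generatedVN (S : Set (𝓗 →L[ℂ] 𝓗)) : VonNeumannAlgebra 𝓗 where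
  toStarSubalgebra :=
    StarSubalgebra.centralizer ℂ (StarSubalgebra.centralizer ℂ S : Set (𝓗 →L[ℂ] 𝓗))
  centralizer_centralizer' := by simp

theorem subset_generatedVN (S : Set (𝓗 →L[ℂ] 𝓗)) :
    S ⊆ (generatedVN S : Set (𝓗 →L[ℂ] 𝓗)) := by
  intro x hx
  change x ∈ StarSubalgebra.centralizer ℂ (StarSubalgebra.centralizer ℂ S : Set (𝓗 →L[ℂ] 𝓗))
  rw [StarSubalgebra.mem_centralizer_iff]
  intro g hg
  have hg' := (StarSubalgebra.mem_centralizer_iff ℂ).1 hg x hx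
  have hg'' := (StarSubalgebra.mem_centralizer_iff ℂ).1
    (star_mem (S := StarSubalgebra ℂ (𝓗 →L[ℂ] 𝓗)) hg) x hx
  exact ⟨hg'.1.symm, hg''.1.symm⟩

/-- The generated von Neumann algebra is the smallest one that contains `S`. -/
theorem generatedVN_le {S : Set (𝓗 →L[ℂ] 𝓗)} {N : VonNeumannAlgebra 𝓗}
    (h : S ⊆ (N : Set (𝓗 →L[ℂ] 𝓗))) : generatedVN S ≤ N := by
  intro x hx
  change x ∈ StarSubalgebra.centralizer ℂ
    (StarSubalgebra.centralizer ℂ S : Set (𝓗 →L[ℂ] 𝓗)) at hx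
  rw [← N.commutant_commutant, VonNeumannAlgebra.mem_commutant_iff]
  intro g hg
  rw [VonNeumannAlgebra.mem_commutant_iff] at hg
  refine ((StarSubalgebra.mem_centralizer_iff ℂ).1 hx g ?_).1
  refine (StarSubalgebra.mem_centralizer_iff ℂ).2 fun s hs => ⟨hg s (h hs), ?_⟩
  exact hg _ (star_mem (S := VonNeumannAlgebra 𝓗) (h hs))

/-- `M` is a factor: it is non-zero and its center consists of the scalars. -/
def IsFactor (M : VonNeumannAlgebra 𝓗) : Prop :=
  (1 : 𝓗 →L[ℂ] 𝓗) ≠ 0 ∧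
    ∀ z : 𝓗 →L[ℂ] 𝓗, z ∈ M → (∀ x ∈ M, z * x = x * z) → ∃ c : ℂ, z = c • 1

/-- `M` is finite: every isometry in `M` is unitary. -/
def IsFiniteVN (M : VonNeumannAlgebra 𝓗) : Prop :=
  ∀ v ∈ M, star v * v = 1 → v * star v = 1

/-- `p` is an abelian projection of `M`: a projection in `M` such that `pMp` is commutative. -/
def IsAbelianProjection (M : VonNeumannAlgebra 𝓗) (p : 𝓗 →L[ℂ] 𝓗) : Prop :=
  p ∈ M ∧ IsStarProjection p ∧
    ∀ x ∈ M, ∀ y ∈ M, (p * x * p) * (p * y * p) = (p * y * p) * (p * x * p)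

/-- `M` is a factor of type II₁: a finite factor without non-zero abelian projections. -/
def IsTypeII₁Factor (M : VonNeumannAlgebra 𝓗) : Prop :=
  IsFactor M ∧ IsFiniteVN M ∧ ∀ p, IsAbelianProjection M p → p = 0

/-- The norm `‖x‖₂ = τ(x* x)^{1/2}` of a trace `τ`. -/
noncomputable def twoNorm (τ : (𝓗 →L[ℂ] 𝓗) → ℂ) (x : 𝓗 →L[ℂ] 𝓗) : ℝ :=
  √(τ (star x * x)).re

/-- `E` is the `τ`-preserving conditional expectation of `M` onto `A`, through its
characterization `E x ∈ A` and `τ(E(x) b) = τ(x b)` for all `x ∈ M` and `b ∈ A`. As the trace `τ`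
is faithful on `A`, this determines `E` on `M`; the values of `E` off `M` are irrelevant. -/
def IsCondExp (τ : (𝓗 →L[ℂ] 𝓗) → ℂ) (M A : VonNeumannAlgebra 𝓗)
    (E : (𝓗 →L[ℂ] 𝓗) → (𝓗 →L[ℂ] 𝓗)) : Prop :=
  ∀ x ∈ M, E x ∈ A ∧ ∀ b ∈ A, τ (E x * b) = τ (x * b)

/-- A set `S` of unitaries of `M` is almost orthonormal: it is infinite and for every `x ∈ M` and
`ε > 0`, one has `|τ(u x)| ≤ ε` for all but finitely many `u ∈ S`. -/
def IsAlmostOrthonormal (τ : (𝓗 →L[ℂ] 𝓗) → ℂ) (M : VonNeumannAlgebra 𝓗)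
    (S : Set (unitary (𝓗 →L[ℂ] 𝓗))) : Prop :=
  S.Infinite ∧ ∀ x ∈ M, ∀ ε : ℝ, 0 < ε → {u ∈ S | ¬ ‖τ ((u : 𝓗 →L[ℂ] 𝓗) * x)‖ ≤ ε}.Finite

/-- The von Neumann subalgebra `A ⊆ M` is strongly mixing in `M` (with trace `τ`): it is abelian,
and for every almost orthonormal infinite subgroup `G` of the unitary group `U(A)` and all
`x, y ∈ M`, `‖E_A(u x u⁻¹ y) - E_A(x) E_A(y)‖₂ → 0` as `u → ∞` in `G`, that is, along the
complements of the finite subsets of `G`. The existence of the conditional expectation `E_A` is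
asserted. -/
def IsStronglyMixing (τ : (𝓗 →L[ℂ] 𝓗) → ℂ) (M A : VonNeumannAlgebra 𝓗) : Prop :=
  A ≤ M ∧ (∀ a ∈ A, ∀ b ∈ A, a * b = b * a) ∧
    ∃ E : (𝓗 →L[ℂ] 𝓗) → (𝓗 →L[ℂ] 𝓗), IsCondExp τ M A E ∧
      ∀ G : Subgroup (unitary (𝓗 →L[ℂ] 𝓗)), (∀ u ∈ G, (u : 𝓗 →L[ℂ] 𝓗) ∈ A) →
        IsAlmostOrthonormal τ M (G : Set (unitary (𝓗 →L[ℂ] 𝓗))) →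
          ∀ x ∈ M, ∀ y ∈ M,
            Tendsto (fun u : G => twoNorm τ
                (E ((u : 𝓗 →L[ℂ] 𝓗) * x * ((u⁻¹ : G) : 𝓗 →L[ℂ] 𝓗) * y) - E x * E y))
              cofinite (𝓝 0)

end VonNeumann

/-! ### Group von Neumann algebras -/

section GroupVN

variable (Γ : Type*) [Group Γ]

/-- The Hilbert space `ℓ²(Γ)`. -/
abbrev ell2 : Type _ := lp (fun _ : Γ => ℂ) 2

variable {Γ}

/-- The left regular representation as isometries, `(λ(g) ξ)(h) = ξ(g⁻¹ h)`. -/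
noncomputable def leftRegIsometry (g : Γ) : ell2 Γ →ₗᵢ[ℂ] ell2 Γ where
  toFun ξ := ⟨fun h => ξ (g⁻¹ * h), by
    have h2 : 0 < (2 : ℝ≥0∞).toReal := by norm_num
    have h1 := (memℓp_gen_iff h2).1 (lp.memℓp ξ)
    exact (memℓp_gen_iff h2).2 ((Equiv.mulLeft g⁻¹).summable_iff.2 h1)⟩
  map_add' _ _ := by ext; rfl
  map_smul' _ _ := by ext; rfl
  norm_map' ξ := by
    have h2 : 0 < (2 : ℝ≥0∞).toReal := by norm_num
    rw [lp.norm_eq_tsum_rpow h2, lp.norm_eq_tsum_rpow h2]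
    congr 1
    exact (Equiv.mulLeft g⁻¹).tsum_eq (fun h => ‖ξ h‖ ^ (2 : ℝ≥0∞).toReal)

/-- The left regular representation `λ` of `Γ` on `ℓ²(Γ)`. -/
noncomputable def leftReg (g : Γ) : ell2 Γ →L[ℂ] ell2 Γ :=
  (leftRegIsometry g).toContinuousLinearMap

theorem leftReg_apply (g h : Γ) (ξ : ell2 Γ) : leftReg g ξ h = ξ (g⁻¹ * h) := rfl

/-- For a subgroup `Γ₀` of `Γ`, the von Neumann algebra `L(Γ₀)` on `ℓ²(Γ)` generated by the
unitaries `λ(g)`, `g ∈ Γ₀`. -/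
noncomputable def subgroupVN (Γ₀ : Subgroup Γ) : VonNeumannAlgebra (ell2 Γ) :=
  generatedVN (leftReg '' (Γ₀ : Set Γ))

variable (Γ) in
/-- The group von Neumann algebra `L(Γ)`. -/
noncomputable def groupVN : VonNeumannAlgebra (ell2 Γ) := generatedVN (Set.range leftReg)

open Classical in
/-- The vector `δ₁` of `ℓ²(Γ)`. -/
noncomputable def deltaOne : ell2 Γ := lp.single 2 (1 : Γ) (1 : ℂ)

/-- The canonical trace `τ(x) = ⟨x δ₁, δ₁⟩` (Mathlib's inner product is conjugate linear in its
first variable). -/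
noncomputable def canonicalTrace (x : ell2 Γ →L[ℂ] ell2 Γ) : ℂ :=
  inner ℂ (deltaOne : ell2 Γ) (x deltaOne)

end GroupVN

end HNNMixing

/-
A product `g * tʲ * g⁻¹` can lie in `Γ₀ = ⟨t⟩` only if `g` commutes with `tʲ`. Up to powers of `t`
on either side, `g` is an element of `Λ` or a reduced word whose conjugates by powers of `t` grow in
length; commuting with `tʲ` excludes the latter and makes the former a fixed point of `φʲ`. Hence
`Γ₀` is malnormal, and since it is infinite and proper, this gives both ICC and (ST).

If `Γ` is ICC, Neumann's lemma on coverings by cosets provides a filter on `Γ` along which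
`g * k * g⁻¹ → ∞` for all `k ≠ 1` at once, so that `λ(g) x λ(g)⁻¹ → τ(x)` weakly for every `x` in
`L(Γ)`. For central `x` this is the factor property; for an abelian projection `p`, comparing the
limits of `τ(p λ(g) p λ(g)⁻¹)` yields `τ(p)³ = 0`.

For strong mixing, `‖E(u x u* y) - E(x) E(y)‖₂` is the norm of the projection to `ℓ²(Γ₀)` of
`w u* (y δ₁)` with `w = x - E(x)`. Approximating `w` by finite sums of `λ(g)`, `g ∉ Γ₀`, and `y δ₁`
by finitely supported vectors reduces this to `w = λ(g)` and a single `δ_h`, where by (ST) only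
finitely many Fourier coefficients of `u*` contribute, each of which tends to `0`.
-/

namespace HNNMixing

section Malnormal

variable {Γ : Type*} [Group Γ]

/-- `Γ₀` is malnormal in `Γ`: it meets each of its conjugates by an element outside `Γ₀`
trivially. -/
def IsMalnormal (Γ₀ : Subgroup Γ) : Prop :=
  ∀ g ∉ Γ₀, ∀ x ∈ Γ₀, g * x * g⁻¹ ∈ Γ₀ → x = 1

namespace IsMalnormal

variable {Γ₀ : Subgroup Γ}

theorem eq_of_mul_mul_mem (hΓ₀ : IsMalnormal Γ₀) {g h x y : Γ} (hg : g ∉ Γ₀) (hx : x ∈ Γ₀)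
    (hy : y ∈ Γ₀) (hgx : g * x * h ∈ Γ₀) (hgy : g * y * h ∈ Γ₀) : x = y := by
  have hconj : g * (x * y⁻¹) * g⁻¹ ∈ Γ₀ := by
    have := Γ₀.mul_mem hgx (Γ₀.inv_mem hgy)
    rwa [show g * x * h * (g * y * h)⁻¹ = g * (x * y⁻¹) * g⁻¹ by group] at this
  exact mul_inv_eq_one.1 (hΓ₀ g hg _ (Γ₀.mul_mem hx (Γ₀.inv_mem hy)) hconj)

theorem conditionST (hΓ₀ : IsMalnormal Γ₀) : ConditionST Γ₀ := by
  intro C hC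
  have hfin : (⋃ g ∈ C, ⋃ h ∈ C, {x | x ∈ Γ₀ ∧ g * x * h ∈ Γ₀}).Finite :=
    C.finite_toSet.biUnion fun g hg => C.finite_toSet.biUnion fun h _ =>
      Set.Subsingleton.finite fun _ hx _ hy =>
        hΓ₀.eq_of_mul_mul_mem (hC g hg) hx.1 hy.1 hx.2 hy.2
  refine ⟨hfin.toFinset, fun x hx => ?_, fun x hx hxE g hg h hh hmem => hxE ?_⟩
  · simp only [Set.Finite.mem_toFinset, Set.mem_iUnion] at hx
    obtain ⟨-, -, -, -, hx, -⟩ := hx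
    exact hx
  · simp only [Set.Finite.mem_toFinset, Set.mem_iUnion]
    exact ⟨g, hg, h, hh, hx, hmem⟩

theorem infinite_conjugates_of_notMem (hΓ₀ : IsMalnormal Γ₀) [Infinite Γ₀] {g : Γ} (hg : g ∉ Γ₀) :
    {x : Γ | ∃ h : Γ, x = h * g * h⁻¹}.Infinite := by
  refine Set.infinite_of_injective_forall_mem (f := fun x : Γ₀ => (x : Γ) * g * (x : Γ)⁻¹)
    (fun x y (hxy : (x : Γ) * g * (x : Γ)⁻¹ = y * g * (y : Γ)⁻¹) => ?_) fun x => ⟨x, rfl⟩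
  have hconj : g * ((x : Γ)⁻¹ * y) * g⁻¹ = (x : Γ)⁻¹ * y :=
    calc g * ((x : Γ)⁻¹ * y) * g⁻¹ = (x : Γ)⁻¹ * (x * g * (x : Γ)⁻¹) * y * g⁻¹ := by group
      _ = (x : Γ)⁻¹ * y := by rw [hxy]; group
  have hmem : (x : Γ)⁻¹ * y ∈ Γ₀ := Γ₀.mul_mem (Γ₀.inv_mem x.2) y.2
  exact Subtype.ext (inv_mul_eq_one.1 (hΓ₀ g hg _ hmem (hconj.symm ▸ hmem)))

theorem isICC (hΓ₀ : IsMalnormal Γ₀) [Infinite Γ₀] (htop : Γ₀ ≠ ⊤) : IsICC Γ := by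
  intro g hg
  by_cases hgΓ₀ : g ∈ Γ₀
  · obtain ⟨a, -, ha⟩ := SetLike.exists_of_lt htop.lt_top
    have hconj : a * g * a⁻¹ ∉ Γ₀ := fun hmem => hg (hΓ₀ a ha g hgΓ₀ hmem)
    refine (hΓ₀.infinite_conjugates_of_notMem hconj).mono ?_
    rintro _ ⟨h, rfl⟩
    exact ⟨h * a, by group⟩
  · exact hΓ₀.infinite_conjugates_of_notMem hgΓ₀

end IsMalnormal

end Malnormal

section StableLetter

open HNNExtension HNNExtension.NormalWord

variable {Λ : Type*} [Group Λ] {H K : Subgroup Λ} (φ : H ≃* K)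

/-- The homomorphism `HNN(Λ, H, K, φ) → ℤ` that kills `Λ` and sends the stable letter to `1`. -/
noncomputable def exponentHom : HNN φ →* Multiplicative ℤ :=
  HNNExtension.lift 1 (Multiplicative.ofAdd 1) (by simp)

theorem exponentHom_stableLetter_zpow (n : ℤ) :
    exponentHom φ (stableLetter φ ^ n) = Multiplicative.ofAdd n := by
  rw [map_zpow, exponentHom, HNNExtension.lift_t, ← ofAdd_zsmul, smul_eq_mul, mul_one]

theorem exponentHom_of (a : Λ) : exponentHom φ (of a) = 1 := by
  simp [exponentHom]

theorem stableLetter_zpow_injective : Function.Injective (stableLetter φ ^ · : ℤ → HNN φ) := by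
  intro n m h
  have h' := congrArg (exponentHom φ) h
  simp only [exponentHom_stableLetter_zpow] at h'
  exact Multiplicative.ofAdd.injective h'

instance infinite_zpowers_stableLetter : Infinite (Subgroup.zpowers (stableLetter φ)) :=
  Infinite.of_injective (fun n : ℤ => ⟨stableLetter φ ^ n, n, rfl⟩) fun _ _ h =>
    stableLetter_zpow_injective φ (congrArg Subtype.val h)

theorem zpowers_stableLetter_ne_top [Nontrivial Λ] :
    Subgroup.zpowers (stableLetter φ) ≠ ⊤ := by
  intro htop
  obtain ⟨a, ha⟩ := exists_ne (1 : Λ)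
  obtain ⟨n, hn : stableLetter φ ^ n = of a⟩ : of a ∈ Subgroup.zpowers (stableLetter φ) :=
    htop ▸ Subgroup.mem_top _
  have hn0 : n = 0 := by
    have := congrArg (exponentHom φ) hn
    rwa [exponentHom_stableLetter_zpow, exponentHom_of, ofAdd_eq_one] at this
  rw [hn0, zpow_zero, eq_comm, map_eq_one_iff _ (of_injective φ.symm)] at hn
  exact ha hn

theorem exists_reducedWord_prod_eq (g : HNN φ) :
    ∃ w : ReducedWord Λ K H, w.prod φ.symm = g := by
  obtain ⟨d⟩ := TransversalPair.nonempty Λ K H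
  exact ⟨(NormalWord.equiv φ.symm d g).toReducedWord,
    (NormalWord.equiv φ.symm d).symm_apply_apply g⟩

theorem length_eq_of_prod_eq {w₁ w₂ : ReducedWord Λ K H}
    (h : w₁.prod φ.symm = w₂.prod φ.symm) : w₁.toList.length = w₂.toList.length := by
  simpa using congrArg List.length (ReducedWord.map_fst_eq_and_of_prod_eq φ.symm h).1

theorem exists_reducedWord_mul_of (w : ReducedWord Λ K H) (a : Λ) :
    ∃ w' : ReducedWord Λ K H, w'.prod φ.symm = w.prod φ.symm * of a ∧
      w'.toList.length = w.toList.length := by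
  rcases w with ⟨c, l, hl⟩
  rcases List.eq_nil_or_concat l with rfl | ⟨l, x, rfl⟩
  · exact ⟨⟨c * a, [], List.isChain_nil⟩, by simp [ReducedWord.prod]⟩
  · simp only [List.concat_eq_append] at hl ⊢
    refine ⟨⟨c, l ++ [(x.1, x.2 * a)], ?_⟩, by simp [ReducedWord.prod, mul_assoc], by simp⟩
    rw [List.isChain_append] at hl ⊢
    refine ⟨hl.1, List.isChain_singleton _, fun y hy z hz => ?_⟩
    obtain rfl : (x.1, x.2 * a) = z := by simpa using hz
    exact hl.2.2 y hy x (by simp)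

/-- The reduced word `w` remains reduced after putting `t⁻¹` in front of it and `t` behind it: no
power of the stable letter cancels against either end of `w` in `t⁻ᵏ w tᵏ`. -/
def IsConjReduced (w : ReducedWord Λ K H) : Prop :=
  ((-1, w.head) :: (w.toList ++ [(1, 1)])).IsChain
    fun a b => a.2 ∈ toSubgroup K H a.1 → a.1 = b.1

variable {φ}

theorem isConjReduced_of_notMem {a : Λ} (ha : a ∉ H) :
    IsConjReduced (⟨a, [], List.isChain_nil⟩ : ReducedWord Λ K H) := by
  simpa [IsConjReduced] using ha

theorem IsConjReduced.exists_conj_pow {w : ReducedWord Λ K H} (hw : IsConjReduced w) (k : ℕ) :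
    ∃ w' : ReducedWord Λ K H, IsConjReduced w' ∧
      w'.prod φ.symm = (stableLetter φ ^ k)⁻¹ * w.prod φ.symm * stableLetter φ ^ k ∧
      w'.toList.length = w.toList.length + 2 * k := by
  induction k with
  | zero => exact ⟨w, hw, by simp, rfl⟩
  | succ k ih =>
    obtain ⟨w', hw', hprod, hlength⟩ := ih
    have hlast : ((-1, w'.head) :: (w'.toList ++ [(1, 1)])).getLast? = some (1, 1) := by
      rw [← List.cons_append, List.getLast?_concat]
    refine ⟨⟨1, (-1, w'.head) :: (w'.toList ++ [(1, 1)]), hw'⟩, ?_, ?_, ?_⟩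
    · exact List.isChain_cons.2 ⟨by simp, List.isChain_append.2
        ⟨hw', List.isChain_singleton _, fun x hx y hy _ => by simp_all⟩⟩
    · calc _ = (stableLetter φ)⁻¹ * w'.prod φ.symm * stableLetter φ := by
            simp [ReducedWord.prod, mul_assoc]
        _ = _ := by rw [hprod]; group
    · simp only [List.length_cons, List.length_append, List.length_nil, hlength]
      omega

theorem mem_partialPow_of_conj_eq (j : ℕ) {a b : Λ}
    (h : (stableLetter φ ^ j)⁻¹ * of a * stableLetter φ ^ j = of b) : b ∈ partialPow φ j a := by
  induction j generalizing a with
  | zero =>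
    have : a = b := of_injective φ.symm (by simpa using h)
    simp [partialPow, this]
  | succ j ih =>
    have ha : a ∈ H := by
      by_contra ha
      obtain ⟨w, -, hprod, hlength⟩ := (isConjReduced_of_notMem ha).exists_conj_pow (φ := φ) (j + 1)
      have := length_eq_of_prod_eq φ (w₁ := w) (w₂ := ⟨b, [], List.isChain_nil⟩)
        (by rw [hprod]; simpa [ReducedWord.prod] using h)
      simp [hlength] at this
    have hb : b ∈ partialPow φ j (φ ⟨a, ha⟩) := ih (by
      rw [← t_inv_mul_of_mul_t, ← h]
      group)
    simpa [partialPow, Part.mem_assert_iff, ha] using hb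

theorem isConjReduced_iff {w : ReducedWord Λ K H} (hnil : w.toList ≠ []) :
    IsConjReduced w ↔ (∀ x ∈ w.toList.head?, w.head ∈ H → -1 = x.1) ∧
      ∀ x ∈ w.toList.getLast?, x.2 ∈ toSubgroup K H x.1 → x.1 = 1 := by
  have hhead : (w.toList ++ [((1 : ℤˣ), (1 : Λ))]).head? = w.toList.head? :=
    List.head?_append_of_ne_nil _ hnil
  simp [IsConjReduced, List.isChain_cons, List.isChain_append, hhead, w.chain]

theorem exists_shorter_of_head_mem {w : ReducedWord Λ K H} {b : Λ} {l : List (ℤˣ × Λ)}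
    (hl : w.toList = (1, b) :: l) (hmem : w.head ∈ H) :
    ∃ w' : ReducedWord Λ K H, w'.toList.length < w.toList.length ∧
      w'.prod φ.symm = (stableLetter φ)⁻¹ * w.prod φ.symm := by
  have hchain := w.chain
  rw [hl, List.isChain_cons] at hchain
  refine ⟨⟨φ ⟨w.head, hmem⟩ * b, l, hchain.2⟩, by simp [hl], ?_⟩
  have ht := t_inv_mul_of_mul_t φ ⟨w.head, hmem⟩
  simp [ReducedWord.prod, hl, ← ht, mul_assoc]

theorem exists_shorter_of_last_mem {w : ReducedWord Λ K H} {a : Λ} {l : List (ℤˣ × Λ)}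
    (hl : w.toList = l ++ [(-1, a)]) (hmem : a ∈ H) :
    ∃ w' : ReducedWord Λ K H, w'.toList.length < w.toList.length ∧
      w'.prod φ.symm = w.prod φ.symm * stableLetter φ := by
  have hchain := w.chain
  rw [hl, List.isChain_append] at hchain
  obtain ⟨w', hprod, hlength⟩ := exists_reducedWord_mul_of φ ⟨w.head, l, hchain.1⟩ (φ ⟨a, hmem⟩)
  refine ⟨w', by simp [hlength, hl], ?_⟩
  have ht := t_inv_mul_of_mul_t φ ⟨a, hmem⟩
  rw [hprod, ← ht]
  simp [ReducedWord.prod, hl, mul_assoc]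

theorem exists_shorter_of_not_isConjReduced {w : ReducedWord Λ K H} (hnil : w.toList ≠ [])
    (hw : ¬ IsConjReduced w) : ∃ w' : ReducedWord Λ K H, w'.toList.length < w.toList.length ∧
      (w'.prod φ.symm = (stableLetter φ)⁻¹ * w.prod φ.symm ∨
        w'.prod φ.symm = w.prod φ.symm * stableLetter φ) := by
  rw [isConjReduced_iff hnil, not_and_or] at hw
  rcases hw with hhead | hlast
  · push Not at hhead
    obtain ⟨⟨u, b⟩, hx, hmem, hu⟩ := hhead
    obtain rfl : u = 1 := (Int.units_eq_one_or u).resolve_right (Ne.symm hu)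
    obtain ⟨l, hl⟩ := List.head?_eq_some_iff.1 hx
    obtain ⟨w', hlt, hprod⟩ := exists_shorter_of_head_mem (φ := φ) hl hmem
    exact ⟨w', hlt, .inl hprod⟩
  · push Not at hlast
    obtain ⟨⟨u, a⟩, hx, hmem, hu⟩ := hlast
    obtain rfl : u = -1 := (Int.units_eq_one_or u).resolve_left hu
    obtain ⟨l, hl⟩ := List.getLast?_eq_some_iff.1 hx
    obtain ⟨w', hlt, hprod⟩ := exists_shorter_of_last_mem (φ := φ) hl hmem
    exact ⟨w', hlt, .inr hprod⟩

theorem exists_zpowers_mul_mul_zpowers (g : HNN φ) :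
    ∃ x ∈ Subgroup.zpowers (stableLetter φ), ∃ y ∈ Subgroup.zpowers (stableLetter φ),
      ∃ w : ReducedWord Λ K H, g = x * w.prod φ.symm * y ∧
        (w.toList = [] ∨ IsConjReduced w) := by
  obtain ⟨w, rfl⟩ := exists_reducedWord_prod_eq φ g
  have ht := Subgroup.mem_zpowers (stableLetter φ)
  induction hn : w.toList.length using Nat.strong_induction_on generalizing w with
  | _ n ih =>
    by_cases hw : w.toList = [] ∨ IsConjReduced w
    · exact ⟨1, one_mem _, 1, one_mem _, w, by simp, hw⟩
    · obtain ⟨w', hlt, hw'⟩ := exists_shorter_of_not_isConjReduced (φ := φ) (not_or.1 hw).1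
        (not_or.1 hw).2
      obtain ⟨x, hx, y, hy, v, hprod, hv⟩ := ih _ (hn ▸ hlt) w' rfl
      rcases hw' with hhead | hlast
      · refine ⟨stableLetter φ * x, mul_mem ht hx, y, hy, v, ?_, hv⟩
        rw [mul_assoc, mul_assoc, ← mul_assoc x, ← hprod, hhead, mul_inv_cancel_left]
      · refine ⟨x, hx, y * (stableLetter φ)⁻¹, mul_mem hy (inv_mem ht), v, ?_, hv⟩
        rw [← mul_assoc, ← hprod, hlast, mul_inv_cancel_right]

/-- No positive power of `φ` has a nontrivial fixed point. -/
def HasNoPeriodicPoints (φ : H ≃* K) : Prop :=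
  ∀ j : ℕ, 1 ≤ j → ∀ h : Λ, h ∈ partialPow φ j h → h = 1

theorem prod_eq_one_of_commute_pow (hφ : HasNoPeriodicPoints φ) {j : ℕ} (hj : 1 ≤ j)
    {w : ReducedWord Λ K H} (hw : w.toList = [] ∨ IsConjReduced w)
    (hcomm : Commute (w.prod φ.symm) (stableLetter φ ^ j)) : w.prod φ.symm = 1 := by
  have hconj : (stableLetter φ ^ j)⁻¹ * w.prod φ.symm * stableLetter φ ^ j = w.prod φ.symm := by
    rw [mul_assoc, hcomm.eq, inv_mul_cancel_left]
  rcases hw with hnil | hw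
  · have hprod : w.prod φ.symm = of w.head := by simp [ReducedWord.prod, hnil]
    rw [hprod] at hconj ⊢
    rw [hφ j hj _ (mem_partialPow_of_conj_eq j hconj), map_one]
  · obtain ⟨w', -, hprod, hlength⟩ := hw.exists_conj_pow (φ := φ) j
    have := length_eq_of_prod_eq φ (hprod.trans hconj)
    omega

theorem mem_zpowers_of_commute_pow (hφ : HasNoPeriodicPoints φ) {j : ℕ} (hj : 1 ≤ j) {g : HNN φ}
    (hcomm : Commute g (stableLetter φ ^ j)) : g ∈ Subgroup.zpowers (stableLetter φ) := by
  obtain ⟨x, hx, y, hy, w, rfl, hw⟩ := exists_zpowers_mul_mul_zpowers g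
  have hcommute : ∀ z ∈ Subgroup.zpowers (stableLetter φ), Commute z (stableLetter φ ^ j) := by
    rintro _ ⟨n, rfl⟩
    exact (Commute.refl _).zpow_left n |>.pow_right j
  have hwcomm : Commute (w.prod φ.symm) (stableLetter φ ^ j) := by
    have := ((hcommute _ (inv_mem hx)).mul_left hcomm).mul_left (hcommute _ (inv_mem hy))
    rwa [mul_assoc x, inv_mul_cancel_left, mul_inv_cancel_right] at this
  rw [prod_eq_one_of_commute_pow hφ hj hw hwcomm, mul_one]
  exact mul_mem hx hy

theorem isMalnormal_zpowers_stableLetter (hφ : HasNoPeriodicPoints φ) :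
    IsMalnormal (Subgroup.zpowers (stableLetter φ)) := by
  rintro g hg _ ⟨n, rfl⟩ ⟨m, hm : stableLetter φ ^ m = g * stableLetter φ ^ n * g⁻¹⟩
  have hmn : m = n := by
    have := congrArg (exponentHom φ) hm
    rw [map_mul, map_mul, map_inv, mul_inv_cancel_comm, exponentHom_stableLetter_zpow,
      exponentHom_stableLetter_zpow] at this
    exact Multiplicative.ofAdd.injective this
  have hcomm : Commute g (stableLetter φ ^ n) := by
    rw [commute_iff_eq, ← mul_inv_eq_iff_eq_mul, ← hm, hmn]
  by_contra hne
  have hn : 1 ≤ n.natAbs := Int.natAbs_pos.2 fun hn => hne (by simp [hn])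
  refine hg (mem_zpowers_of_commute_pow hφ hn ?_)
  rcases Int.natAbs_eq n with h | h
  · rwa [← zpow_natCast, ← h]
  · rw [h, zpow_neg, zpow_natCast] at hcomm
    exact Commute.inv_right_iff.1 hcomm

end StableLetter

section EllTwo

variable {Γ : Type*}

theorem ell2_hasSum_sq (ξ : ell2 Γ) : HasSum (fun k => ‖ξ k‖ ^ 2) (‖ξ‖ ^ 2) := by
  simpa using lp.hasSum_norm (by norm_num) ξ

theorem ell2_sum_sq_le (ξ : ell2 Γ) (s : Finset Γ) : ∑ k ∈ s, ‖ξ k‖ ^ 2 ≤ ‖ξ‖ ^ 2 :=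
  sum_le_hasSum s (fun _ _ => by positivity) (ell2_hasSum_sq ξ)

theorem ell2_tendsto_cofinite (ξ : ell2 Γ) : Tendsto (fun k => ξ k) cofinite (𝓝 0) := by
  rw [tendsto_zero_iff_norm_tendsto_zero]
  simpa [Real.sqrt_sq] using (ell2_hasSum_sq ξ).summable.tendsto_cofinite_zero.sqrt

theorem memℓp_two_of_sum_sq_le {f : Γ → ℂ} {C : ℝ}
    (h : ∀ s : Finset Γ, ∑ k ∈ s, ‖f k‖ ^ 2 ≤ C) : Memℓp f 2 :=
  memℓp_gen' (C := C) (by simpa using h)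

theorem ell2_norm_le_of_sum_sq_le {ξ : ell2 Γ} {C : ℝ} (hC : 0 ≤ C)
    (h : ∀ s : Finset Γ, ∑ k ∈ s, ‖ξ k‖ ^ 2 ≤ C ^ 2) : ‖ξ‖ ≤ C :=
  lp.norm_le_of_forall_sum_le (by norm_num) hC (by simpa using h)

open Classical in
/-- The standard basis vector `δ_g` of `ℓ²(Γ)`; `delta 1` is `deltaOne` by definition. -/
noncomputable def delta (g : Γ) : ell2 Γ := lp.single 2 g (1 : ℂ)

open Classical in
theorem delta_apply (g k : Γ) : delta g k = if k = g then (1 : ℂ) else 0 := by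
  simp only [delta, lp.coeFn_single, Pi.single_apply]

theorem delta_apply_of_ne {g k : Γ} (h : k ≠ g) : delta g k = (0 : ℂ) := by
  rw [delta_apply, if_neg h]

theorem delta_apply_congr {a b c d : Γ} (h : a = b ↔ c = d) : delta b a = delta d c := by
  classical
  rw [delta_apply, delta_apply, if_congr h rfl rfl]

theorem inner_delta_left (g : Γ) (ξ : ell2 Γ) : inner ℂ (delta g) ξ = ξ g := by
  classical
  simp [delta, lp.inner_single_left]

theorem norm_delta (g : Γ) : ‖delta g‖ = 1 := by
  classical
  simp [delta, lp.norm_single]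

theorem hasSum_delta (ξ : ell2 Γ) : HasSum (fun k => ξ k • delta k) ξ := by
  classical
  convert lp.hasSum_single (p := 2) (by norm_num) ξ using 2 with k
  rw [delta, ← lp.single_smul, smul_eq_mul, mul_one]

theorem hasSum_ell2_apply {ι : Type*} {f : ι → ell2 Γ} {ξ : ell2 Γ} (h : HasSum f ξ) (k : Γ) :
    HasSum (fun i => f i k) (ξ k) := by
  simpa only [innerSL_apply_apply, inner_delta_left] using h.mapL (innerSL ℂ (delta k))

theorem clm_ext_delta {S T : ell2 Γ →L[ℂ] ell2 Γ} (h : ∀ g, S (delta g) = T (delta g)) :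
    S = T := by
  ext1 ξ
  refine ((hasSum_delta ξ).mapL S).unique ?_
  simpa only [map_smul, h] using (hasSum_delta ξ).mapL T

theorem star_apply_delta (X : ell2 Γ →L[ℂ] ell2 Γ) (h k : Γ) :
    star X (delta h) k = star (X (delta k) h) := by
  rw [← inner_delta_left, ContinuousLinearMap.star_eq_adjoint,
    ContinuousLinearMap.adjoint_inner_right, ← inner_conj_symm, inner_delta_left]
  rfl

theorem tendsto_apply_delta_cofinite (Y : ell2 Γ →L[ℂ] ell2 Γ) (k : Γ) :
    Tendsto (fun h => Y (delta h) k) cofinite (𝓝 0) := by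
  have := (ell2_tendsto_cofinite (star Y (delta k))).star
  simpa only [star_apply_delta, star_star, star_zero] using this

theorem hasSum_clm_apply (X : ell2 Γ →L[ℂ] ell2 Γ) (ξ : ell2 Γ) (k : Γ) :
    HasSum (fun h => ξ h * X (delta h) k) (X ξ k) := by
  simpa using hasSum_ell2_apply ((hasSum_delta ξ).mapL X) k

theorem tendsto_apply_of_tendsto_delta {E ι : Type*} [NormedAddCommGroup E] [NormedSpace ℂ E]
    {l : Filter ι} {T : ι → ell2 Γ →L[ℂ] E} {T₀ : ell2 Γ →L[ℂ] E}
    (hbdd : ∃ C, ∀ i ξ, ‖T i ξ‖ ≤ C * ‖ξ‖)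
    (hdelta : ∀ g, Tendsto (fun i => T i (delta g)) l (𝓝 (T₀ (delta g)))) (ξ : ell2 Γ) :
    Tendsto (fun i => T i ξ) l (𝓝 (T₀ ξ)) := by
  have hequi : Equicontinuous ((↑) ∘ T : ι → ell2 Γ → E) :=
    ((NormedSpace.equicontinuous_TFAE T).out 1 3).2 hbdd
  refine (hequi.isClosed_setOfPred_tendsto T₀.continuous).mem_of_tendsto (hasSum_delta ξ) <|
    .of_forall fun s => ?_
  simp only [Set.mem_ofPred_eq, Function.comp_apply, map_sum, map_smul]
  exact tendsto_finsetSum s fun g _ => (hdelta g).const_smul _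

/-- The projection of `ℓ²(Γ)` onto the functions supported on `s`. -/
noncomputable def mask (s : Set Γ) : ell2 Γ →L[ℂ] ell2 Γ :=
  LinearMap.mkContinuous
    { toFun := fun ξ => ⟨s.indicator ξ, memℓp_two_of_sum_sq_le (C := ‖ξ‖ ^ 2) fun F =>
        (Finset.sum_le_sum fun k _ => by
          gcongr
          exact norm_indicator_le_norm_self _ _).trans (ell2_sum_sq_le ξ F)⟩
      map_add' := fun ξ η => by
        ext k
        exact congrFun (Set.indicator_add s (ξ : Γ → ℂ) η) k
      map_smul' := fun c ξ => by
        ext k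
        exact congrFun (Set.indicator_const_smul s c (ξ : Γ → ℂ)) k } 1
    fun ξ => by
      rw [one_mul]
      exact lp.norm_mono (by norm_num) fun k => norm_indicator_le_norm_self _ _

theorem mask_apply (s : Set Γ) (ξ : ell2 Γ) (k : Γ) : mask s ξ k = s.indicator ξ k := rfl

theorem mask_apply_of_mem {s : Set Γ} {k : Γ} (hk : k ∈ s) (ξ : ell2 Γ) : mask s ξ k = ξ k :=
  Set.indicator_of_mem hk _

theorem mask_apply_of_notMem {s : Set Γ} {k : Γ} (hk : k ∉ s) (ξ : ell2 Γ) : mask s ξ k = 0 :=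
  Set.indicator_of_notMem hk _

theorem mask_delta_of_mem {s : Set Γ} {g : Γ} (hg : g ∈ s) : mask s (delta g) = delta g := by
  ext k
  by_cases hk : k ∈ s
  · rw [mask_apply_of_mem hk]
  · rw [mask_apply_of_notMem hk, delta_apply_of_ne (ne_of_mem_of_not_mem hg hk).symm]

theorem mask_delta_of_notMem {s : Set Γ} {g : Γ} (hg : g ∉ s) : mask s (delta g) = 0 := by
  ext k
  by_cases hk : k ∈ s
  · rw [mask_apply_of_mem hk, delta_apply_of_ne (ne_of_mem_of_not_mem hk hg)]
    rfl
  · rw [mask_apply_of_notMem hk]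
    rfl

theorem norm_mask_le (s : Set Γ) (ξ : ell2 Γ) : ‖mask s ξ‖ ≤ ‖ξ‖ :=
  lp.norm_mono (by norm_num) fun _ => norm_indicator_le_norm_self _ _

theorem sum_sq_norm_mask_fiber_le {Q : Type*} (π : Γ → Q) (ξ : ell2 Γ) (F : Finset Q) :
    ∑ q ∈ F, ‖mask (π ⁻¹' {q}) ξ‖ ^ 2 ≤ ‖ξ‖ ^ 2 := by
  classical
  refine hasSum_le (fun k => ?_)
    (hasSum_sum fun q (_ : q ∈ F) => ell2_hasSum_sq (mask (π ⁻¹' {q}) ξ)) (ell2_hasSum_sq ξ)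
  have : ∀ q ∈ F, ‖mask (π ⁻¹' {q}) ξ k‖ ^ 2 = if π k = q then ‖ξ k‖ ^ 2 else 0 := by
    intro q _
    rw [mask_apply, Set.indicator_apply]
    simp only [Set.mem_preimage, Set.mem_singleton_iff]
    split_ifs <;> simp
  rw [Finset.sum_congr rfl this, Finset.sum_ite_eq]
  split_ifs
  · exact le_rfl
  · positivity

theorem sum_sq_compress_le {Q : Type*} (π : Γ → Q) (X : ell2 Γ →L[ℂ] ell2 Γ) (ξ : ell2 Γ)
    (F : Finset Γ) :
    ∑ k ∈ F, ‖X (mask (π ⁻¹' {π k}) ξ) k‖ ^ 2 ≤ (‖X‖ * ‖ξ‖) ^ 2 := by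
  classical
  calc ∑ k ∈ F, ‖X (mask (π ⁻¹' {π k}) ξ) k‖ ^ 2
      = ∑ q ∈ F.image π, ∑ k ∈ F with π k = q, ‖X (mask (π ⁻¹' {π k}) ξ) k‖ ^ 2 :=
        (Finset.sum_fiberwise_of_maps_to (fun k hk => Finset.mem_image_of_mem π hk) _).symm
    _ ≤ ∑ q ∈ F.image π, (‖X‖ * ‖mask (π ⁻¹' {q}) ξ‖) ^ 2 := by
        refine Finset.sum_le_sum fun q _ => ?_
        calc ∑ k ∈ F with π k = q, ‖X (mask (π ⁻¹' {π k}) ξ) k‖ ^ 2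
            = ∑ k ∈ F with π k = q, ‖X (mask (π ⁻¹' {q}) ξ) k‖ ^ 2 :=
              Finset.sum_congr rfl fun k hk => by rw [(Finset.mem_filter.1 hk).2]
          _ ≤ ‖X (mask (π ⁻¹' {q}) ξ)‖ ^ 2 := ell2_sum_sq_le _ _
          _ ≤ _ := by
              gcongr
              exact X.le_opNorm _
    _ = ‖X‖ ^ 2 * ∑ q ∈ F.image π, ‖mask (π ⁻¹' {q}) ξ‖ ^ 2 := by
        rw [Finset.mul_sum]
        exact Finset.sum_congr rfl fun q _ => mul_pow _ _ _
    _ ≤ ‖X‖ ^ 2 * ‖ξ‖ ^ 2 := by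
        gcongr
        exact sum_sq_norm_mask_fiber_le π ξ _
    _ = _ := (mul_pow _ _ _).symm

/-- The block diagonal compression of `X` with respect to the partition of `Γ` into the fibers
of `π`. -/
noncomputable def compress {Q : Type*} (π : Γ → Q) (X : ell2 Γ →L[ℂ] ell2 Γ) :
    ell2 Γ →L[ℂ] ell2 Γ :=
  LinearMap.mkContinuous
    { toFun := fun ξ => ⟨fun k => X (mask (π ⁻¹' {π k}) ξ) k,
        memℓp_two_of_sum_sq_le (sum_sq_compress_le π X ξ)⟩
      map_add' := fun ξ η => by
        ext k
        change X (mask _ (ξ + η)) k = X (mask _ ξ) k + X (mask _ η) k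
        rw [map_add, map_add]
        rfl
      map_smul' := fun c ξ => by
        ext k
        change X (mask _ (c • ξ)) k = c • X (mask _ ξ) k
        rw [map_smul, map_smul]
        rfl } ‖X‖
    fun ξ => ell2_norm_le_of_sum_sq_le (by positivity) (sum_sq_compress_le π X ξ)

theorem compress_apply {Q : Type*} (π : Γ → Q) (X : ell2 Γ →L[ℂ] ell2 Γ) (ξ : ell2 Γ) (k : Γ) :
    compress π X ξ k = X (mask (π ⁻¹' {π k}) ξ) k := rfl

open Classical in
theorem compress_delta {Q : Type*} (π : Γ → Q) (X : ell2 Γ →L[ℂ] ell2 Γ) (h k : Γ) :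
    compress π X (delta h) k = if π h = π k then X (delta h) k else 0 := by
  rw [compress_apply]
  split_ifs with hp
  · rw [mask_delta_of_mem (show h ∈ π ⁻¹' {π k} from hp)]
  · rw [mask_delta_of_notMem (show h ∉ π ⁻¹' {π k} from hp), map_zero]
    rfl

end EllTwo

section Convolution

variable {Γ : Type*} [Group Γ]

theorem leftReg_delta (g h : Γ) : leftReg g (delta h) = delta (g * h) := by
  ext k
  exact delta_apply_congr inv_mul_eq_iff_eq_mul

theorem leftReg_mul (g h : Γ) : leftReg (g * h) = leftReg g * leftReg h := by
  ext ξ k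
  simp only [mul_apply_eq_comp, leftReg_apply, mul_inv_rev, mul_assoc]

theorem norm_leftReg_apply (g : Γ) (ξ : ell2 Γ) : ‖leftReg g ξ‖ = ‖ξ‖ :=
  (leftRegIsometry g).norm_map ξ

theorem star_leftReg (g : Γ) : star (leftReg g) = leftReg g⁻¹ := by
  refine clm_ext_delta fun h => ?_
  ext k
  classical
  rw [star_apply_delta, leftReg_delta, leftReg_delta, delta_apply, delta_apply, apply_ite star,
    star_one, star_zero]
  exact if_congr (by rw [eq_inv_mul_iff_mul_eq, eq_comm]) rfl rfl

/-- The right regular representation of `Γ` as isometries, `(ρ(g) ξ)(h) = ξ(h g)`. -/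
noncomputable def rightRegIsometry (g : Γ) : ell2 Γ →ₗᵢ[ℂ] ell2 Γ where
  toFun ξ := ⟨fun h => ξ (h * g), (memℓp_gen_iff (by norm_num)).2
    ((Equiv.mulRight g).summable_iff.2 ((memℓp_gen_iff (by norm_num)).1 (lp.memℓp ξ)))⟩
  map_add' _ _ := by ext; rfl
  map_smul' _ _ := by ext; rfl
  norm_map' ξ := by
    rw [lp.norm_eq_tsum_rpow (by norm_num), lp.norm_eq_tsum_rpow (by norm_num)]
    congr 1
    exact (Equiv.mulRight g).tsum_eq (fun h => ‖ξ h‖ ^ (2 : ℝ≥0∞).toReal)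

/-- The right regular representation of `Γ` on `ℓ²(Γ)`. -/
noncomputable def rightReg (g : Γ) : ell2 Γ →L[ℂ] ell2 Γ :=
  (rightRegIsometry g).toContinuousLinearMap

theorem rightReg_apply (g h : Γ) (ξ : ell2 Γ) : rightReg g ξ h = ξ (h * g) := rfl

theorem norm_rightReg_apply (g : Γ) (ξ : ell2 Γ) : ‖rightReg g ξ‖ = ‖ξ‖ :=
  (rightRegIsometry g).norm_map ξ

theorem rightReg_delta (g h : Γ) : rightReg g (delta h) = delta (h * g⁻¹) := by
  ext k
  exact delta_apply_congr eq_mul_inv_iff_mul_eq.symm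

theorem leftReg_mul_rightReg (g h : Γ) : leftReg g * rightReg h = rightReg h * leftReg g := by
  ext ξ k
  simp only [mul_apply_eq_comp, leftReg_apply, rightReg_apply, mul_assoc]

/-- `X` is left convolution by the vector `X δ₁`. These operators make up `L(Γ)`, see
`mem_groupVN_iff`. -/
def IsConvolution (X : ell2 Γ →L[ℂ] ell2 Γ) : Prop :=
  ∀ h k, X (delta h) k = X (delta 1) (k * h⁻¹)

theorem IsConvolution.of_commute {X : ell2 Γ →L[ℂ] ell2 Γ}
    (h : ∀ g, X * rightReg g = rightReg g * X) : IsConvolution X := by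
  intro a k
  have : X (delta a) = rightReg a⁻¹ (X (delta 1)) := by
    rw [← mul_apply_eq_comp, ← h, mul_apply_eq_comp, rightReg_delta, inv_inv, one_mul]
  rw [this, rightReg_apply]

theorem IsConvolution.apply_delta {X : ell2 Γ →L[ℂ] ell2 Γ} (hX : IsConvolution X) (h : Γ) :
    X (delta h) = rightReg h⁻¹ (X (delta 1)) := by
  ext k
  exact hX h k

theorem IsConvolution.hasSum_apply_delta {X : ell2 Γ →L[ℂ] ell2 Γ} (hX : IsConvolution X)
    (h : Γ) : HasSum (fun g => X (delta 1) g • delta (g * h)) (X (delta h)) := by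
  rw [hX.apply_delta h]
  simpa only [map_smul, rightReg_delta, inv_inv] using
    (hasSum_delta (X (delta 1))).mapL (rightReg h⁻¹)

theorem IsConvolution.hasSum_apply {X : ell2 Γ →L[ℂ] ell2 Γ} (hX : IsConvolution X)
    (ξ : ell2 Γ) (k : Γ) : HasSum (fun g => X (delta 1) g * ξ (g⁻¹ * k)) (X ξ k) := by
  convert ((Equiv.inv Γ).trans (Equiv.mulRight k)).hasSum_iff.2 (hasSum_clm_apply X ξ k)
    using 2 with g
  simp only [Function.comp_apply, Equiv.trans_apply, Equiv.inv_apply, Equiv.coe_mulRight]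
  rw [hX (g⁻¹ * k), mul_inv_rev, inv_inv, mul_inv_cancel_left, mul_comm]

theorem IsConvolution.mul_comm_of_support {X T : ell2 Γ →L[ℂ] ell2 Γ} (hX : IsConvolution X)
    {s : Set Γ} (hs : ∀ g ∉ s, X (delta 1) g = 0)
    (hT : ∀ g ∈ s, leftReg g * T = T * leftReg g) : T * X = X * T := by
  refine clm_ext_delta fun h => ?_
  ext k
  refine (hasSum_ell2_apply ((hX.hasSum_apply_delta h).mapL T) k).unique ?_
  rw [mul_apply_eq_comp]
  convert hX.hasSum_apply (T (delta h)) k using 2 with g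
  by_cases hg : g ∈ s
  · rw [← leftReg_apply, ← mul_apply_eq_comp, hT g hg, mul_apply_eq_comp, leftReg_delta, map_smul]
    rfl
  · rw [hs g hg, zero_smul, map_zero, zero_mul]
    rfl

end Convolution

section GroupVonNeumann

variable {Γ : Type*} [Group Γ]

theorem mem_subgroupVN_iff_commute {Γ₀ : Subgroup Γ} {X : ell2 Γ →L[ℂ] ell2 Γ} :
    X ∈ subgroupVN Γ₀ ↔
      ∀ T : ell2 Γ →L[ℂ] ell2 Γ, (∀ g ∈ Γ₀, leftReg g * T = T * leftReg g) → T * X = X * T := by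
  have hcentralizer : ∀ T : ell2 Γ →L[ℂ] ell2 Γ,
      T ∈ StarSubalgebra.centralizer ℂ (leftReg '' (Γ₀ : Set Γ)) ↔
        ∀ g ∈ Γ₀, leftReg g * T = T * leftReg g := by
    intro T
    rw [StarSubalgebra.mem_centralizer_iff]
    constructor
    · exact fun h g hg => (h _ ⟨g, hg, rfl⟩).1
    · rintro h _ ⟨g, hg, rfl⟩
      rw [star_leftReg]
      exact ⟨h g hg, h _ (inv_mem hg)⟩
  change X ∈ StarSubalgebra.centralizer ℂ
    (StarSubalgebra.centralizer ℂ (leftReg '' (Γ₀ : Set Γ)) : Set (ell2 Γ →L[ℂ] ell2 Γ)) ↔ _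
  rw [StarSubalgebra.mem_centralizer_iff]
  constructor
  · exact fun h T hT => (h T ((hcentralizer T).2 hT)).1
  · intro h T hT
    exact ⟨h T ((hcentralizer T).1 hT), h _ ((hcentralizer _).1 (star_mem hT))⟩

theorem leftReg_mul_mask {Γ₀ : Subgroup Γ} {a : Γ} (ha : a ∈ Γ₀) :
    leftReg a * mask (Γ₀ : Set Γ) = mask (Γ₀ : Set Γ) * leftReg a := by
  ext ξ k
  simp only [mul_apply_eq_comp, leftReg_apply]
  by_cases hk : k ∈ Γ₀
  · rw [mask_apply_of_mem hk, mask_apply_of_mem (mul_mem (inv_mem ha) hk), leftReg_apply]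
  · rw [mask_apply_of_notMem hk, mask_apply_of_notMem]
    exact fun hk' => hk ((Subgroup.mul_mem_cancel_left _ (inv_mem ha)).1 hk')

theorem mem_subgroupVN_iff {Γ₀ : Subgroup Γ} {X : ell2 Γ →L[ℂ] ell2 Γ} :
    X ∈ subgroupVN Γ₀ ↔ IsConvolution X ∧ ∀ g ∉ Γ₀, X (delta 1) g = 0 := by
  rw [mem_subgroupVN_iff_commute]
  constructor
  · intro h
    refine ⟨.of_commute fun g => (h _ fun a _ => leftReg_mul_rightReg a g).symm, fun g hg => ?_⟩
    have hmask := h (mask (Γ₀ : Set Γ)) fun a ha => leftReg_mul_mask ha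
    calc X (delta 1) g = (X * mask (Γ₀ : Set Γ)) (delta 1) g := by
          rw [mul_apply_eq_comp, mask_delta_of_mem (one_mem Γ₀)]
      _ = 0 := by rw [← hmask, mul_apply_eq_comp, mask_apply_of_notMem hg]
  · rintro ⟨hX, hs⟩ T hT
    exact hX.mul_comm_of_support (s := (Γ₀ : Set Γ)) hs hT

theorem groupVN_eq_subgroupVN_top : groupVN Γ = subgroupVN (⊤ : Subgroup Γ) := by
  rw [groupVN, subgroupVN, Subgroup.coe_top, Set.image_univ]

theorem mem_groupVN_iff {X : ell2 Γ →L[ℂ] ell2 Γ} : X ∈ groupVN Γ ↔ IsConvolution X := by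
  rw [groupVN_eq_subgroupVN_top, mem_subgroupVN_iff]
  simp

theorem leftReg_mem_groupVN (g : Γ) : leftReg g ∈ groupVN Γ :=
  subset_generatedVN _ ⟨g, rfl⟩

theorem smul_mem_groupVN (c : ℂ) {X : ell2 Γ →L[ℂ] ell2 Γ} (hX : X ∈ groupVN Γ) :
    c • X ∈ groupVN Γ :=
  (groupVN Γ).toStarSubalgebra.smul_mem hX c

theorem eq_of_apply_delta_one {X Y : ell2 Γ →L[ℂ] ell2 Γ} (hX : X ∈ groupVN Γ)
    (hY : Y ∈ groupVN Γ) (h : X (delta 1) = Y (delta 1)) : X = Y :=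
  clm_ext_delta fun g => by
    rw [(mem_groupVN_iff.1 hX).apply_delta, (mem_groupVN_iff.1 hY).apply_delta, h]

theorem canonicalTrace_apply (X : ell2 Γ →L[ℂ] ell2 Γ) : canonicalTrace X = X (delta 1) 1 :=
  inner_delta_left 1 (X (delta 1))

theorem canonicalTrace_smul (c : ℂ) (X : ell2 Γ →L[ℂ] ell2 Γ) :
    canonicalTrace (c • X) = c * canonicalTrace X := by
  rw [canonicalTrace_apply, canonicalTrace_apply, smul_apply, lp.coeFn_smul, Pi.smul_apply,
    smul_eq_mul]

theorem canonicalTrace_mul_leftReg (X : ell2 Γ →L[ℂ] ell2 Γ) (g : Γ) :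
    canonicalTrace (X * leftReg g) = X (delta g) 1 := by
  rw [canonicalTrace_apply, mul_apply_eq_comp, leftReg_delta, mul_one]

theorem canonicalTrace_mul_comm {X Y : ell2 Γ →L[ℂ] ell2 Γ} (hX : X ∈ groupVN Γ)
    (hY : Y ∈ groupVN Γ) : canonicalTrace (X * Y) = canonicalTrace (Y * X) := by
  rw [canonicalTrace_apply, canonicalTrace_apply, mul_apply_eq_comp, mul_apply_eq_comp]
  refine ((mem_groupVN_iff.1 hX).hasSum_apply (Y (delta 1)) 1).unique ?_
  convert (Equiv.inv Γ).hasSum_iff.2 ((mem_groupVN_iff.1 hY).hasSum_apply (X (delta 1)) 1)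
    using 2 with g
  simp only [Function.comp_apply, Equiv.inv_apply, inv_inv, mul_one, mul_comm]

theorem canonicalTrace_star_mul_self (X : ell2 Γ →L[ℂ] ell2 Γ) :
    canonicalTrace (star X * X) = (‖X (delta 1)‖ ^ 2 : ℝ) := by
  change inner ℂ (delta 1) ((star X * X) (delta 1)) = _
  rw [mul_apply_eq_comp, ContinuousLinearMap.star_eq_adjoint,
    ContinuousLinearMap.adjoint_inner_right, inner_self_eq_norm_sq_to_K]
  norm_cast

theorem twoNorm_canonicalTrace (X : ell2 Γ →L[ℂ] ell2 Γ) :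
    twoNorm canonicalTrace X = ‖X (delta 1)‖ := by
  rw [twoNorm, canonicalTrace_star_mul_self, Complex.ofReal_re, Real.sqrt_sq (norm_nonneg _)]

theorem norm_mul_apply_delta_of_mul_star_eq_one {X U : ell2 Γ →L[ℂ] ell2 Γ}
    (hX : X ∈ groupVN Γ) (hU : U ∈ groupVN Γ) (h : U * star U = 1) (g : Γ) :
    ‖(X * U) (delta g)‖ = ‖X (delta 1)‖ := by
  rw [(mem_groupVN_iff.1 (mul_mem hX hU)).apply_delta, norm_rightReg_apply]
  have htrace : canonicalTrace (star (X * U) * (X * U)) = canonicalTrace (star X * X) := by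
    rw [star_mul, mul_assoc, canonicalTrace_mul_comm (star_mem hU)
      (mul_mem (star_mem hX) (mul_mem hX hU)), mul_assoc, mul_assoc, h, mul_one]
  rw [canonicalTrace_star_mul_self, canonicalTrace_star_mul_self, Complex.ofReal_inj] at htrace
  exact (sq_eq_sq₀ (norm_nonneg _) (norm_nonneg _)).1 htrace

theorem eq_zero_of_isStarProjection_of_canonicalTrace {p : ell2 Γ →L[ℂ] ell2 Γ}
    (hp : p ∈ groupVN Γ) (hproj : IsStarProjection p) (htrace : canonicalTrace p = 0) :
    p = 0 := by
  have hpp : star p * p = p := by rw [hproj.isSelfAdjoint.star_eq, hproj.isIdempotentElem.eq]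
  have hnorm := canonicalTrace_star_mul_self p
  rw [hpp, htrace, eq_comm, Complex.ofReal_eq_zero, sq_eq_zero_iff, norm_eq_zero] at hnorm
  exact eq_of_apply_delta_one hp (zero_mem _) hnorm

theorem isFiniteVN_groupVN : IsFiniteVN (groupVN Γ) := by
  intro v hv hiso
  have hproj : IsStarProjection (1 - v * star v) := by
    refine IsStarProjection.one_sub ⟨?_, ?_⟩
    · rw [IsIdempotentElem, mul_assoc, ← mul_assoc (star v), hiso, one_mul]
    · exact IsSelfAdjoint.mul_star_self v
  refine (sub_eq_zero.1 (eq_zero_of_isStarProjection_of_canonicalTrace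
    (sub_mem (one_mem _) (mul_mem hv (star_mem hv))) hproj ?_)).symm
  have htrace := canonicalTrace_mul_comm hv (star_mem hv)
  rw [hiso, canonicalTrace_apply, canonicalTrace_apply] at htrace
  rw [canonicalTrace_apply, sub_apply, lp.coeFn_sub, Pi.sub_apply, htrace, sub_self]

end GroupVonNeumann

section OrbitFilter

variable {G X : Type*} [Group G] [MulAction G X]

theorem exists_forall_smul_ne {ι : Type*} {s : Finset ι} {x : ι → X}
    (hx : ∀ i ∈ s, (MulAction.orbit G (x i)).Infinite) (y : ι → X) :
    ∃ g : G, ∀ i ∈ s, g • x i ≠ y i := by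
  -- Otherwise `G` is a finite union of cosets of the stabilizers of the `x i`, and by
  -- B. H. Neumann's lemma one of these has finite index.
  by_contra! h
  have hmove : ∀ i, ∃ c : G, (∃ g : G, g • x i = y i) → c • x i = y i := fun i =>
    (em (∃ g : G, g • x i = y i)).elim (fun ⟨g, hg⟩ => ⟨g, fun _ => hg⟩)
      fun hi => ⟨1, fun h' => (hi h').elim⟩
  choose c hc using hmove
  obtain ⟨i, hi, hfin⟩ := Subgroup.exists_finiteIndex_of_leftCoset_cover (s := s) (g := c)
    (H := fun i => MulAction.stabilizer G (x i)) <| Set.eq_univ_of_forall fun g => by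
      obtain ⟨i, hi, hg⟩ := h g
      refine Set.mem_biUnion hi (Set.mem_smul_set_iff_inv_smul_mem.2 ?_)
      change ((c i)⁻¹ * g) • x i = x i
      rw [mul_smul, hg, inv_smul_eq_iff, hc i ⟨g, hg⟩]
  exact hfin.index_ne_zero ((MulAction.index_stabilizer G (x i)).trans (hx i hi).ncard)

theorem neBot_iInf_comap_smul_cofinite {s : Set X}
    (hs : ∀ x ∈ s, (MulAction.orbit G x).Infinite) :
    (⨅ x ∈ s, comap (fun g : G => g • x) cofinite).NeBot := by
  refine ⟨fun hbot => ?_⟩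
  rw [← empty_mem_iff_bot, iInf_subtype', mem_iInf] at hbot
  obtain ⟨I, hI, V, hV, hempty⟩ := hbot
  choose t ht htV using hV
  have := hI.to_subtype
  have := fun i => (show (t i)ᶜ.Finite from ht i).to_subtype
  have := Fintype.ofFinite (Σ i : I, ((t i)ᶜ : Set X))
  obtain ⟨g, hg⟩ := exists_forall_smul_ne (G := G) (s := Finset.univ)
    (x := fun j : Σ i : I, ((t i)ᶜ : Set X) => (j.1.1 : X)) (fun j _ => hs _ j.1.1.2)
    fun j => j.2.1
  have hmem : g ∈ ⋂ i, V i := Set.mem_iInter.2 fun i => htV i <| by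
    by_contra hgt
    exact hg ⟨i, _, hgt⟩ (Finset.mem_univ _) rfl
  rwa [← hempty] at hmem

end OrbitFilter

section Factor

variable {Γ : Type*} [Group Γ]

variable (Γ) in
/-- The filter of the `g` in `Γ` for which `g k g⁻¹ → ∞` simultaneously for all `k ≠ 1`. -/
def conjInfty : Filter Γ :=
  ⨅ k ∈ ({1}ᶜ : Set Γ), comap (fun g => g * k * g⁻¹) cofinite

theorem IsICC.neBot_conjInfty (hΓ : IsICC Γ) : (conjInfty Γ).NeBot :=
  neBot_iInf_comap_smul_cofinite (G := ConjAct Γ) fun k hk =>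
    (hΓ k hk).mono <| by
      rintro _ ⟨h, rfl⟩
      exact ⟨ConjAct.toConjAct h, rfl⟩

theorem tendsto_conj_conjInfty {k : Γ} (hk : k ≠ 1) :
    Tendsto (fun g => g * k * g⁻¹) (conjInfty Γ) cofinite :=
  tendsto_iff_comap.2 (iInf₂_le k hk)

theorem conjInfty_le_cofinite [Nontrivial Γ] : conjInfty Γ ≤ cofinite := by
  obtain ⟨k, hk⟩ := exists_ne (1 : Γ)
  exact (iInf₂_le k hk).trans (comap_cofinite_le _)

theorem tendsto_mul_conj_apply {X : ell2 Γ →L[ℂ] ell2 Γ} (hX : X ∈ groupVN Γ)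
    (Y : ell2 Γ →L[ℂ] ell2 Γ) (k : Γ) :
    Tendsto (fun g => (Y * (leftReg g * X * leftReg g⁻¹)) (delta 1) k) (conjInfty Γ)
      (𝓝 (canonicalTrace X * Y (delta 1) k)) := by
  let T : Γ → ell2 Γ →L[ℂ] ℂ := fun g => innerSL ℂ (delta k) ∘L Y ∘L leftReg g ∘L rightReg g
  have hT : ∀ g ξ, T g ξ = Y (leftReg g (rightReg g ξ)) k := fun g ξ => inner_delta_left _ _
  have hdelta : ∀ h, Tendsto (fun g => T g (delta h)) (conjInfty Γ)
      (𝓝 ((Y (delta 1) k • innerSL ℂ (delta 1)) (delta h))) := by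
    intro h
    simp only [hT, rightReg_delta, leftReg_delta, smul_apply, innerSL_apply_apply,
      inner_delta_left, smul_eq_mul, ← mul_assoc]
    by_cases hh : h = 1
    · simp only [hh, mul_one, mul_inv_cancel, delta_apply, if_true]
      exact tendsto_const_nhds
    · rw [delta_apply_of_ne (Ne.symm hh), mul_zero]
      exact (tendsto_apply_delta_cofinite Y k).comp (tendsto_conj_conjInfty hh)
  have hbdd : ∀ g ξ, ‖T g ξ‖ ≤ ‖Y‖ * ‖ξ‖ := by
    intro g ξ
    calc ‖T g ξ‖ ≤ ‖Y (leftReg g (rightReg g ξ))‖ := by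
          rw [hT]
          exact lp.norm_apply_le_norm two_ne_zero _ _
      _ ≤ ‖Y‖ * ‖ξ‖ := by
          rw [← norm_rightReg_apply g ξ, ← norm_leftReg_apply g (rightReg g ξ)]
          exact Y.le_opNorm _
  convert tendsto_apply_of_tendsto_delta ⟨_, hbdd⟩ hdelta (X (delta 1)) using 2 with g
  · simp only [hT, mul_apply_eq_comp, leftReg_delta, mul_one,
      (mem_groupVN_iff.1 hX).apply_delta g⁻¹, inv_inv]
  · rw [smul_apply, innerSL_apply_apply, inner_delta_left, smul_eq_mul, mul_comm,
      canonicalTrace_apply]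

theorem isFactor_groupVN (hΓ : IsICC Γ) : IsFactor (groupVN Γ) := by
  have := hΓ.neBot_conjInfty
  refine ⟨fun h => ?_, fun z hz hcomm => ⟨canonicalTrace z, ?_⟩⟩
  · have hnorm := norm_delta (1 : Γ)
    rw [← one_apply_eq_self (F := ell2 Γ →L[ℂ] ell2 Γ) (delta (1 : Γ)), h, zero_apply,
      norm_zero] at hnorm
    exact zero_ne_one hnorm
  · refine eq_of_apply_delta_one hz (smul_mem_groupVN _ (one_mem _)) ?_
    ext k
    refine tendsto_nhds_unique (f := fun _ : Γ => z (delta 1) k) tendsto_const_nhds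
      ((tendsto_mul_conj_apply hz 1 k).congr fun g => ?_)
    rw [one_mul, ← hcomm _ (leftReg_mem_groupVN g), mul_assoc, ← leftReg_mul, mul_inv_cancel]
    simp only [mul_apply_eq_comp, leftReg_delta, mul_one]

theorem IsAbelianProjection.smul_compression_eq (hΓ : IsICC Γ) {p a : ell2 Γ →L[ℂ] ell2 Γ}
    (hp : IsAbelianProjection (groupVN Γ) p) (ha : a ∈ groupVN Γ) :
    canonicalTrace p • (p * a * p) = canonicalTrace (p * a * p) • p := by
  obtain ⟨hpM, hproj, hcomm⟩ := hp
  have := hΓ.neBot_conjInfty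
  have hpap : p * a * p ∈ groupVN Γ := mul_mem (mul_mem hpM ha) hpM
  refine eq_of_apply_delta_one (smul_mem_groupVN _ hpap) (smul_mem_groupVN _ hpM) ?_
  ext k
  -- The two sides are the weak limits of `(pap)(gpg⁻¹)` and `p(g(pap)g⁻¹)`, which agree because
  -- `pgp` commutes with `pap`.
  refine tendsto_nhds_unique (tendsto_mul_conj_apply hpM (p * a * p) k)
    ((tendsto_mul_conj_apply hpap p k).congr fun g => ?_)
  have hpp : p * p = p := hproj.isIdempotentElem.eq
  have hswap : p * leftReg g * (p * a * p) = p * a * p * (leftReg g * p) := by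
    simpa only [mul_assoc, hpp, ← mul_assoc p p] using hcomm _ (leftReg_mem_groupVN g) a ha
  rw [← mul_assoc, ← mul_assoc, hswap, mul_assoc]

theorem IsAbelianProjection.eq_zero [Nontrivial Γ] (hΓ : IsICC Γ) {p : ell2 Γ →L[ℂ] ell2 Γ}
    (hp : IsAbelianProjection (groupVN Γ) p) : p = 0 := by
  have := hΓ.neBot_conjInfty
  refine eq_zero_of_isStarProjection_of_canonicalTrace hp.1 hp.2.1 ?_
  have htrace : ∀ g, canonicalTrace p * canonicalTrace (p * (leftReg g * p * leftReg g⁻¹)) =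
      p (delta g) 1 * p (delta g⁻¹) 1 := by
    intro g
    have hcompress : canonicalTrace (p * leftReg g * p) = p (delta g) 1 := by
      rw [canonicalTrace_mul_comm (mul_mem hp.1 (leftReg_mem_groupVN g)) hp.1, ← mul_assoc,
        hp.2.1.isIdempotentElem.eq, canonicalTrace_mul_leftReg]
    rw [← hcompress, ← canonicalTrace_mul_leftReg]
    simpa only [smul_mul_assoc, canonicalTrace_smul, mul_assoc] using
      congrArg (fun a => canonicalTrace (a * leftReg g⁻¹))
        (hp.smul_compression_eq hΓ (leftReg_mem_groupVN g))
  have hcube : canonicalTrace p * (canonicalTrace p * canonicalTrace p) = 0 * 0 := by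
    have hleft : Tendsto (fun g => canonicalTrace (p * (leftReg g * p * leftReg g⁻¹)))
        (conjInfty Γ) (𝓝 (canonicalTrace p * canonicalTrace p)) := by
      simpa only [canonicalTrace_apply] using tendsto_mul_conj_apply hp.1 p 1
    have hright : Tendsto (fun g => p (delta g) 1 * p (delta g⁻¹) 1) cofinite (𝓝 (0 * 0)) :=
      (tendsto_apply_delta_cofinite p 1).mul
        ((tendsto_apply_delta_cofinite p 1).comp inv_injective.tendsto_cofinite)
    refine tendsto_nhds_unique (hleft.const_mul (canonicalTrace p)) ?_
    simpa only [htrace] using hright.mono_left conjInfty_le_cofinite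
  simpa using hcube

theorem isTypeII₁Factor_groupVN [Nontrivial Γ] (hΓ : IsICC Γ) : IsTypeII₁Factor (groupVN Γ) :=
  ⟨isFactor_groupVN hΓ, isFiniteVN_groupVN, fun _ hp => hp.eq_zero hΓ⟩

end Factor

section CondExp

variable {Γ : Type*} [Group Γ] {Γ₀ : Subgroup Γ}

theorem mask_mul_of_mem_subgroupVN {X : ell2 Γ →L[ℂ] ell2 Γ} (hX : X ∈ subgroupVN Γ₀) :
    mask (Γ₀ : Set Γ) * X = X * mask (Γ₀ : Set Γ) :=
  mem_subgroupVN_iff_commute.1 hX _ fun _ ha => leftReg_mul_mask ha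

theorem mask_apply_of_mem_subgroupVN {X : ell2 Γ →L[ℂ] ell2 Γ} (hX : X ∈ subgroupVN Γ₀)
    (ξ : ell2 Γ) : mask (Γ₀ : Set Γ) (X ξ) = X (mask (Γ₀ : Set Γ) ξ) := by
  rw [← mul_apply_eq_comp, mask_mul_of_mem_subgroupVN hX, mul_apply_eq_comp]

theorem subgroupVN_le_groupVN (Γ₀ : Subgroup Γ) : subgroupVN Γ₀ ≤ groupVN Γ :=
  fun _ hX => mem_groupVN_iff.2 (mem_subgroupVN_iff.1 hX).1

theorem subgroupVN_commutative (h : ∀ a ∈ Γ₀, ∀ b ∈ Γ₀, a * b = b * a) :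
    ∀ a ∈ subgroupVN Γ₀, ∀ b ∈ subgroupVN Γ₀, a * b = b * a := by
  intro a ha b hb
  refine mem_subgroupVN_iff_commute.1 hb a fun g hg => ?_
  refine mem_subgroupVN_iff_commute.1 ha _ fun k hk => ?_
  rw [← leftReg_mul, ← leftReg_mul, h k hk g hg]

/-- The trace preserving conditional expectation of `L(Γ)` onto `L(Γ₀)`: the block diagonal
compression with respect to the cosets `Γ₀ g`. -/
noncomputable def condExp (Γ₀ : Subgroup Γ) (X : ell2 Γ →L[ℂ] ell2 Γ) :
    ell2 Γ →L[ℂ] ell2 Γ :=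
  compress (Quotient.mk (QuotientGroup.rightRel Γ₀)) X

theorem mk_rightRel_eq_iff {h k : Γ} :
    Quotient.mk (QuotientGroup.rightRel Γ₀) h = Quotient.mk (QuotientGroup.rightRel Γ₀) k ↔
      k * h⁻¹ ∈ Γ₀ := by
  rw [Quotient.eq, QuotientGroup.rightRel_apply]

theorem condExp_apply_of_mem (X : ell2 Γ →L[ℂ] ell2 Γ) (ξ : ell2 Γ) {k : Γ} (hk : k ∈ Γ₀) :
    condExp Γ₀ X ξ k = X (mask (Γ₀ : Set Γ) ξ) k := by
  have hfiber : Quotient.mk (QuotientGroup.rightRel Γ₀) ⁻¹'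
      {Quotient.mk (QuotientGroup.rightRel Γ₀) k} = (Γ₀ : Set Γ) := by
    ext g
    rw [Set.mem_preimage, Set.mem_singleton_iff, eq_comm, mk_rightRel_eq_iff]
    exact Subgroup.mul_mem_cancel_right _ (inv_mem hk)
  rw [condExp, compress_apply, hfiber]

theorem condExp_mem (Γ₀ : Subgroup Γ) {X : ell2 Γ →L[ℂ] ell2 Γ} (hX : X ∈ groupVN Γ) :
    condExp Γ₀ X ∈ subgroupVN Γ₀ := by
  classical
  rw [mem_subgroupVN_iff]
  constructor
  · intro h k
    rw [condExp, compress_delta, compress_delta, mem_groupVN_iff.1 hX h k]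
    simp only [mk_rightRel_eq_iff, inv_one, mul_one]
  · intro g hg
    rw [condExp, compress_delta, if_neg]
    rwa [mk_rightRel_eq_iff, inv_one, mul_one]

theorem condExp_apply_delta_one (Γ₀ : Subgroup Γ) {X : ell2 Γ →L[ℂ] ell2 Γ}
    (hX : X ∈ groupVN Γ) : condExp Γ₀ X (delta 1) = mask (Γ₀ : Set Γ) (X (delta 1)) := by
  ext k
  by_cases hk : k ∈ Γ₀
  · rw [condExp_apply_of_mem X _ hk, mask_delta_of_mem (one_mem Γ₀), mask_apply_of_mem hk]
  · rw [(mem_subgroupVN_iff.1 (condExp_mem Γ₀ hX)).2 k hk, mask_apply_of_notMem hk]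

theorem isCondExp_condExp (Γ₀ : Subgroup Γ) :
    IsCondExp canonicalTrace (groupVN Γ) (subgroupVN Γ₀) (condExp Γ₀) := by
  intro X hX
  refine ⟨condExp_mem Γ₀ hX, fun b hb => ?_⟩
  rw [canonicalTrace_apply, canonicalTrace_apply, mul_apply_eq_comp, mul_apply_eq_comp,
    condExp_apply_of_mem X _ (one_mem Γ₀), mask_apply_of_mem_subgroupVN hb,
    mask_delta_of_mem (one_mem Γ₀)]

end CondExp

section Mixing

variable {Γ : Type*} [Group Γ] {Γ₀ : Subgroup Γ}

theorem ConditionST.finite (hST : ConditionST Γ₀) {g : Γ} (hg : g ∉ Γ₀) (h : Γ) :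
    {r | r ∈ Γ₀ ∧ g * (r * h) ∈ Γ₀}.Finite := by
  classical
  by_cases hh : h ∈ Γ₀
  · convert Set.finite_empty
    refine Set.eq_empty_of_forall_notMem fun r hr => hg ?_
    exact (Subgroup.mul_mem_cancel_right _ (mul_mem hr.1 hh)).1 hr.2
  · obtain ⟨E, -, hE⟩ := hST {g, h} (by simp [hg, hh])
    refine E.finite_toSet.subset fun r hr => ?_
    by_contra hrE
    exact hE r hr.1 hrE g (by simp) h (by simp) (mul_assoc g r h ▸ hr.2)

variable {ι : Type*} {l : Filter ι} {v : ι → ell2 Γ →L[ℂ] ell2 Γ}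

theorem ConditionST.tendsto_mask_leftReg (hST : ConditionST Γ₀) (hv : ∀ i, v i ∈ subgroupVN Γ₀)
    (hweak : ∀ r, Tendsto (fun i => v i (delta 1) r) l (𝓝 0)) {g : Γ} (hg : g ∉ Γ₀) (h : Γ) :
    Tendsto (fun i => mask (Γ₀ : Set Γ) (leftReg g (v i (delta h)))) l (𝓝 0) := by
  set R := (hST.finite hg h).toFinset with hR
  have hsum : ∀ i, mask (Γ₀ : Set Γ) (leftReg g (v i (delta h))) =
      ∑ r ∈ R, v i (delta 1) r • mask (Γ₀ : Set Γ) (delta (g * (r * h))) := by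
    intro i
    obtain ⟨hconv, hsupp⟩ := mem_subgroupVN_iff.1 (hv i)
    have hall := (hconv.hasSum_apply_delta h).mapL (mask (Γ₀ : Set Γ) ∘L leftReg g)
    simp only [ContinuousLinearMap.comp_apply, map_smul, leftReg_delta] at hall
    refine hall.unique (hasSum_sum_of_ne_finset_zero fun r hr => ?_)
    by_cases hr₀ : r ∈ Γ₀
    · rw [mask_delta_of_notMem fun hmem => hr (by simpa [hR] using ⟨hr₀, hmem⟩), smul_zero]
    · rw [hsupp r hr₀, zero_smul]
  simp only [hsum]
  simpa only [zero_smul, Finset.sum_const_zero] using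
    tendsto_finsetSum R fun r _ => (hweak r).smul_const (mask (Γ₀ : Set Γ) (delta (g * (r * h))))

theorem tendsto_mul_apply_delta_of_leftReg {X P : ell2 Γ →L[ℂ] ell2 Γ} (hX : X ∈ groupVN Γ)
    (hv : ∀ i, v i ∈ groupVN Γ) (hunit : ∀ i, v i * star (v i) = 1) {h : Γ}
    (hP : ∀ g, X (delta 1) g ≠ 0 → Tendsto (fun i => P (leftReg g (v i (delta h)))) l (𝓝 0)) :
    Tendsto (fun i => P (X (v i (delta h)))) l (𝓝 0) := by
  let z : Finset Γ → ell2 Γ →L[ℂ] ell2 Γ := fun s => ∑ g ∈ s, X (delta 1) g • leftReg g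
  have hz : ∀ s, z s ∈ groupVN Γ := fun s =>
    sum_mem fun g _ => smul_mem_groupVN _ (leftReg_mem_groupVN g)
  have happrox : Tendsto (fun s => ‖P‖ * ‖(X - z s) (delta 1)‖) atTop (𝓝 0) := by
    have hsum : Tendsto (fun s => z s (delta 1)) atTop (𝓝 (X (delta 1))) := by
      have hpartial : ∀ s, z s (delta 1) = ∑ g ∈ s, X (delta 1) g • delta g := fun s => by
        simp only [z, sum_apply, smul_apply, leftReg_delta, mul_one]
      simp only [hpartial]
      exact hasSum_delta (X (delta 1))
    simpa [sub_apply] using ((tendsto_const_nhds (x := X (delta 1))).sub hsum).norm.const_mul ‖P‖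
  have hunif : TendstoUniformly (fun s i => P (z s (v i (delta h))))
      (fun i => P (X (v i (delta h)))) atTop := by
    rw [Metric.tendstoUniformly_iff]
    intro ε hε
    filter_upwards [happrox.eventually (gt_mem_nhds hε)] with s hs i
    calc dist (P (X (v i (delta h)))) (P (z s (v i (delta h))))
        = ‖P (((X - z s) * v i) (delta h))‖ := by
          rw [dist_eq_norm, ← map_sub, mul_apply_eq_comp, sub_apply]
      _ ≤ ‖P‖ * ‖((X - z s) * v i) (delta h)‖ := P.le_opNorm _
      _ = ‖P‖ * ‖(X - z s) (delta 1)‖ := by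
          rw [norm_mul_apply_delta_of_mul_star_eq_one (sub_mem hX (hz s)) (hv i) (hunit i)]
      _ < ε := hs
  refine hunif.tendsto_of_eventually_tendsto (.of_forall fun s => ?_) tendsto_const_nhds
  simp only [z, sum_apply, smul_apply, map_sum, map_smul]
  rw [← Finset.sum_const_zero (s := s)]
  refine tendsto_finsetSum s fun g _ => ?_
  by_cases hg : X (delta 1) g = 0
  · simpa only [hg, zero_smul] using tendsto_const_nhds
  · simpa only [smul_zero] using (hP g hg).const_smul (X (delta 1) g)

theorem ConditionST.tendsto_mask_mul (hST : ConditionST Γ₀) {X : ell2 Γ →L[ℂ] ell2 Γ}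
    (hX : X ∈ groupVN Γ) (hX₀ : ∀ g ∈ Γ₀, X (delta 1) g = 0) (hv : ∀ i, v i ∈ subgroupVN Γ₀)
    (hunitary : ∀ i, v i ∈ unitary (ell2 Γ →L[ℂ] ell2 Γ))
    (hweak : ∀ r, Tendsto (fun i => v i (delta 1) r) l (𝓝 0)) (ξ : ell2 Γ) :
    Tendsto (fun i => mask (Γ₀ : Set Γ) (X (v i ξ))) l (𝓝 0) := by
  let T : ι → ell2 Γ →L[ℂ] ell2 Γ := fun i => mask (Γ₀ : Set Γ) ∘L X ∘L v i
  have hbdd : ∀ i η, ‖T i η‖ ≤ ‖X‖ * ‖η‖ := by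
    intro i η
    calc ‖T i η‖ ≤ ‖X (v i η)‖ := norm_mask_le (Γ₀ : Set Γ) (X (v i η))
      _ ≤ ‖X‖ * ‖v i η‖ := X.le_opNorm _
      _ = ‖X‖ * ‖η‖ := by rw [ContinuousLinearMap.norm_map_of_mem_unitary (hunitary i)]
  have hdelta : ∀ h, Tendsto (fun i => T i (delta h)) l (𝓝 0) := fun h =>
    tendsto_mul_apply_delta_of_leftReg hX (fun i => subgroupVN_le_groupVN Γ₀ (hv i))
      (fun i => Unitary.mul_star_self_of_mem (hunitary i)) fun g hg =>
        hST.tendsto_mask_leftReg hv hweak (fun hmem => hg (hX₀ g hmem)) h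
  exact tendsto_apply_of_tendsto_delta (T := T) (T₀ := 0) ⟨_, hbdd⟩ hdelta ξ

theorem IsAlmostOrthonormal.tendsto {M : VonNeumannAlgebra (ell2 Γ)}
    {S : Set (unitary (ell2 Γ →L[ℂ] ell2 Γ))} (hS : IsAlmostOrthonormal canonicalTrace M S)
    {x : ell2 Γ →L[ℂ] ell2 Γ} (hx : x ∈ M) :
    Tendsto (fun u : S => canonicalTrace ((u : ell2 Γ →L[ℂ] ell2 Γ) * x)) cofinite (𝓝 0) := by
  refine Metric.nhds_basis_closedBall.tendsto_right_iff.2 fun ε hε => ?_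
  refine ((hS.2 x hx ε hε).preimage Subtype.val_injective.injOn).subset fun u hu => ⟨u.2, ?_⟩
  simpa using hu

theorem IsAlmostOrthonormal.tendsto_star_apply_delta_one
    {S : Set (unitary (ell2 Γ →L[ℂ] ell2 Γ))}
    (hS : IsAlmostOrthonormal canonicalTrace (groupVN Γ) S) (r : Γ) :
    Tendsto (fun u : S => star (u : ell2 Γ →L[ℂ] ell2 Γ) (delta 1) r) cofinite (𝓝 0) := by
  have htrace := (hS.tendsto (leftReg_mem_groupVN r)).star
  simpa only [canonicalTrace_mul_leftReg, ← star_apply_delta, star_zero] using htrace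

theorem condExp_conj_mul_sub_apply_delta_one
    (hcomm : ∀ a ∈ subgroupVN Γ₀, ∀ b ∈ subgroupVN Γ₀, a * b = b * a)
    {x y u : ell2 Γ →L[ℂ] ell2 Γ} (hx : x ∈ groupVN Γ) (hy : y ∈ groupVN Γ)
    (hu : u ∈ subgroupVN Γ₀) (hunit : u * star u = 1) :
    (condExp Γ₀ (u * x * star u * y) - condExp Γ₀ x * condExp Γ₀ y) (delta 1) =
      u (mask (Γ₀ : Set Γ) ((x - condExp Γ₀ x) (star u (y (delta 1))))) := by
  have hEx := condExp_mem Γ₀ hx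
  have huM := subgroupVN_le_groupVN Γ₀ hu
  have hconj : condExp Γ₀ x = u * condExp Γ₀ x * star u := by
    rw [hcomm u hu _ hEx, mul_assoc, hunit, mul_one]
  have hleft : condExp Γ₀ (u * x * star u * y) (delta 1) =
      u (mask (Γ₀ : Set Γ) (x (star u (y (delta 1))))) := by
    rw [condExp_apply_delta_one Γ₀ (mul_mem (mul_mem (mul_mem huM hx) (star_mem huM)) hy),
      ← mask_apply_of_mem_subgroupVN hu]
    simp only [mul_apply_eq_comp]
  have hright : (condExp Γ₀ x * condExp Γ₀ y) (delta 1) =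
      u (mask (Γ₀ : Set Γ) (condExp Γ₀ x (star u (y (delta 1))))) := by
    rw [mul_apply_eq_comp, condExp_apply_delta_one Γ₀ hy, ← mask_apply_of_mem_subgroupVN hu,
      ← mask_apply_of_mem_subgroupVN hEx]
    conv_lhs => rw [hconj]
    simp only [mul_apply_eq_comp]
  rw [sub_apply, hleft, hright, ← map_sub, ← map_sub, sub_apply]

theorem ConditionST.isStronglyMixing (hST : ConditionST Γ₀)
    (hab : ∀ a ∈ Γ₀, ∀ b ∈ Γ₀, a * b = b * a) :
    IsStronglyMixing canonicalTrace (groupVN Γ) (subgroupVN Γ₀) := by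
  have hcomm := subgroupVN_commutative hab
  refine ⟨subgroupVN_le_groupVN Γ₀, hcomm, condExp Γ₀, isCondExp_condExp Γ₀, ?_⟩
  intro G hG hao x hx y hy
  have hw₀ : ∀ g ∈ Γ₀, (x - condExp Γ₀ x) (delta 1) g = 0 := by
    intro g hg
    rw [sub_apply, condExp_apply_delta_one Γ₀ hx, lp.coeFn_sub, Pi.sub_apply,
      mask_apply_of_mem hg, sub_self]
  have hw : x - condExp Γ₀ x ∈ groupVN Γ :=
    sub_mem hx (subgroupVN_le_groupVN Γ₀ (condExp_mem Γ₀ hx))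
  have hmask := hST.tendsto_mask_mul hw hw₀ (fun u : G => star_mem (hG u u.2))
    (fun u => Unitary.star_mem u.1.2) hao.tendsto_star_apply_delta_one (y (delta 1))
  refine (tendsto_zero_iff_norm_tendsto_zero.1 hmask).congr fun u => ?_
  change _ = twoNorm canonicalTrace (condExp Γ₀ ((u : ell2 Γ →L[ℂ] ell2 Γ) * x *
    star (u : ell2 Γ →L[ℂ] ell2 Γ) * y) - condExp Γ₀ x * condExp Γ₀ y)
  rw [twoNorm_canonicalTrace, condExp_conj_mul_sub_apply_delta_one hcomm hx hy (hG u u.2)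
    (Unitary.mul_star_self_of_mem u.1.2), ContinuousLinearMap.norm_map_of_mem_unitary u.1.2]

end Mixing

end HNNMixing

theorem corollary4p7_general {Λ : Type*} [Group Λ] [Nontrivial Λ]
    (H K : Subgroup Λ) (φ : H ≃* K)
    (hφ : ∀ j : ℕ, 1 ≤ j → ∀ h : Λ, h ∈ HNNMixing.partialPow φ j h → h = 1) :
    HNNMixing.IsICC (HNNMixing.HNN φ) ∧
      HNNMixing.ConditionST (Subgroup.zpowers (HNNMixing.stableLetter φ)) ∧
      HNNMixing.IsTypeII₁Factor (HNNMixing.groupVN (HNNMixing.HNN φ)) ∧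
      HNNMixing.IsStronglyMixing HNNMixing.canonicalTrace
        (HNNMixing.groupVN (HNNMixing.HNN φ))
        (HNNMixing.subgroupVN (Subgroup.zpowers (HNNMixing.stableLetter φ))) := by
  have hmal := HNNMixing.isMalnormal_zpowers_stableLetter hφ
  have hICC := hmal.isICC (HNNMixing.zpowers_stableLetter_ne_top φ)
  have hnontrivial := (HNNMixing.stableLetter_zpow_injective φ).nontrivial
  refine ⟨hICC, hmal.conditionST, HNNMixing.isTypeII₁Factor_groupVN hICC,
    hmal.conditionST.isStronglyMixing ?_⟩
  rintro _ ⟨n, rfl⟩ _ ⟨m, rfl⟩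
  exact (Commute.refl _).zpow_zpow n m

theorem corollary4p7 {Λ : Type*} [Group Λ] [Countable Λ] [Nontrivial Λ]
    (H K : Subgroup Λ) (φ : H ≃* K)
    (hφ : ∀ j : ℕ, 1 ≤ j → ∀ h : Λ, h ∈ HNNMixing.partialPow φ j h → h = 1) :
    HNNMixing.IsICC (HNNMixing.HNN φ) ∧
      HNNMixing.ConditionST (Subgroup.zpowers (HNNMixing.stableLetter φ)) ∧
      HNNMixing.IsTypeII₁Factor (HNNMixing.groupVN (HNNMixing.HNN φ)) ∧
      HNNMixing.IsStronglyMixing HNNMixing.canonicalTrace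
        (HNNMixing.groupVN (HNNMixing.HNN φ))
        (HNNMixing.subgroupVN (Subgroup.zpowers (HNNMixing.stableLetter φ))) :=
  corollary4p7_general H K φ hφ
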